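/- **Setting.** Let $S$ be a compact Borel space (a compact metrizable space with its Borel $\sigma$-algebra), $A$ and $\mathcal Z$ Borel spaces (Borel subsets of Polish spaces), $N\ge 1$, $\beta\in(0,1)$. For $x\in S$ let $D(x)\subset A$ be the set of admissible actions; $D:=\{(x,a)\in S\times A: a\in D(x)\}$ is measurable and contains the graph of a measurable map $S\to A$. For a Borel space $E$ let $\mathbb P(E)$ be the set of probability measures on $E$ with the weak topology and its Borel $\sigma$-algebra; for $y\in E^N$ let $\mu[y]:=\frac1N\sum_{i=1}^N\delta_{y_i}$, and $\mathbb P_N(E):=\{\mu[y]: y\in E^N\}\subset\mathbb P(E)$. Let $T:S\times A\times\mathbb P(S)\times\mathcal Z\times\mathcal Z\to S$ be measurable and $r:S\times A\times\mathbb P(S)\to\mathbb R$ bounded. Let $Z_n^i$ ($n\ge1$, $0\le i\le N$) be independent $\mathcal Z$-valued random variables such that all $Z_n^i$ with $i\ge1$ have the same law and all $Z_n^0$ have the same law; $\mathbf Z_n:=(Z_n^1,\dots,Z_n^N)$. For $\mathbf x\in S^N$ put $\mathbf D(\mathbf x):=D(x_1)\times\dots\times D(x_N)$, and for $\mathbf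 a\in\mathbf D(\mathbf x)$ put $\mathbf T(\mathbf x,\mathbf a,\mathbf z,z^0):=\big(T(x_i,a_i,\mu[\mathbf x],z^i,z^0)\big)_{i=1,\dots,N}$. *The $N$-individual MDP.* A policy is a sequence $\pi=(f_0,f_1,\dots)$ of measurable maps $f_k:S^N\to A^N$ with $f_k(\mathbf x)\in\mathbf D(\mathbf x)$ for all $\mathbf x$. With $\mathbf X_0=\mathbf x$, $\mathbf A_k=f_k(\mathbf X_k)$, $\mathbf X_{k+1}=\mathbf T(\mathbf X_k,\mathbf A_k,\mathbf Z_{k+1},Z^0_{k+1})$ let $$V^N(\mathbf x):=\sup_\pi\ \frac1N\sum_{i=1}^N\sum_{k=0}^\infty\beta^k\,\mathbb E^\pi_{\mathbf x}\big[r(X_k^i,A_k^i,\mu[\mathbf X_k])\big].$$ *The mean-field MDP.* The state space is $\mathbb P_N(S)$ and the action space is $\mathbb P_N(D)$. In state $\mu$ the admissible actions are the empirical measures of $N$ points of $D$ whose first marginal is $\mu$, i.e. the elements of $\hat D(\mu):=\{\mu[(\mathbf x,\mathbf a)]:\mathbf x\in S^N,\ \mu[\mathbf x]=\mu,\ \mathbf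 a\in\mathbf D(\mathbf x)\}$. The reward is $\hat r(\mu,Q):=\int_D r(x,a,\mu)\,Q(d(x,a))$. If the state is $\mu$ and the action is $Q=\mu[(\mathbf x,\mathbf a)]\in\hat D(\mu)$ with $\mu[\mathbf x]=\mu$, then the next state has the law of $\mu[\mathbf T(\mathbf x,\mathbf a,\mathbf Z_1,Z_1^0)]$ (which does not depend on the chosen representation $(\mathbf x,\mathbf a)$ of $Q$). A policy is a sequence $\psi=(\varphi_0,\varphi_1,\dots)$ of measurable maps $\varphi_k:\mathbb P_N(S)\to\mathbb P_N(D)$ with $\varphi_k(\mu)\in\hat D(\mu)$ for all $\mu$. If $(\mu_k)$ is the Markov process with $\mu_0=\mu$ that this transition law and $\psi$ generate, then $$J^N(\mu):=\sup_\psi\ \sum_{k=0}^\infty\beta^k\,\mathbb E^\psi_\mu\big[\hat r(\mu_k,\varphi_k(\mu_k))\big].$$ **Theorem.** Assume - (A0) $D$ is compact; - (A1) $x\mapsto D(x)$ is upper semicontinuous, i.e. if $x_n\to x$ in $S$ and $a_n\in D(x_n)$, then $(a_n)$ has an accumulation point in $D(x)$; - (A2) $(x,a,\mu)\mapsto r(x,a,\mu)$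 is upper semicontinuous; - (A3) $(x,a,\mu)\mapsto T(x,a,\mu,z,z_0)$ is continuous for all $z,z_0\in\mathcal Z$. Then for every $\mathbf x\in S^N$ $$V^N(\mathbf x)=J^N(\mu[\mathbf x]).$$ -/

import Mathlib

open MeasureTheory ProbabilityTheory Filter Topology
open scoped ENNReal

noncomputable section

namespace MeanFieldMDP

/-! ### Empirical measures -/

section Empirical

variable {E : Type*} [MeasurableSpace E] {N : ℕ} [NeZero N]

/-- The empirical measure `μ[y] = (1/N) ∑ᵢ δ_{yᵢ}` of `N` points. -/
def empirical (y : Fin N → E) : ProbabilityMeasure E :=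
  ⟨(N : ℝ≥0∞)⁻¹ • ∑ i, Measure.dirac (y i), ⟨by
    simp [ENNReal.inv_mul_cancel (Nat.cast_ne_zero.2 (NeZero.ne N)) (ENNReal.natCast_ne_top N)]⟩⟩

lemma empirical_apply (y : Fin N → E) (s : Set E) :
    (empirical y : Measure E) s = (N : ℝ≥0∞)⁻¹ * ∑ i, Measure.dirac (y i) s := by
  simp [empirical]

lemma measurable_empirical : Measurable (empirical : (Fin N → E) → ProbabilityMeasure E) := by
  refine Measurable.subtype_mk (Measure.measurable_of_measurable_coe _ fun s hs => ?_)
  simp only [Measure.smul_apply, Measure.finsetSum_apply, smul_eq_mul]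
  refine Measurable.const_mul (Finset.measurable_sum _ fun i _ => ?_) _
  exact (Measure.measurable_coe hs).comp (Measure.measurable_dirac.comp (measurable_pi_apply i))

variable (E N) in
/-- The set `P_N(E)` of all probability measures on `E` that are empirical measures of `N` points.
It carries the trace of the `σ`-algebra of Mathlib on probability measures (generated by the
evaluations `μ ↦ μ B`), which is the Borel `σ`-algebra of the weak topology when `E` is a
separable metrizable space with its Borel `σ`-algebra. -/
abbrev EmpiricalMeasures : Type _ :=
  {μ : ProbabilityMeasure E // ∃ y : Fin N → E, empirical y = μ}

/-- The empirical measure as an element of `P_N(E)`. -/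
def emp (y : Fin N → E) : EmpiricalMeasures E N := ⟨empirical y, y, rfl⟩

lemma measurable_emp : Measurable (emp : (Fin N → E) → EmpiricalMeasures E N) :=
  measurable_empirical.subtype_mk

lemma emp_surjective : Function.Surjective (emp : (Fin N → E) → EmpiricalMeasures E N) := by
  rintro ⟨_, y, rfl⟩
  exact ⟨y, rfl⟩

lemma emp_comp_perm (y : Fin N → E) (σ : Equiv.Perm (Fin N)) : emp (y ∘ σ) = emp y := by
  refine Subtype.ext (Subtype.ext ?_)
  change (N : ℝ≥0∞)⁻¹ • ∑ i, Measure.dirac (y (σ i)) = (N : ℝ≥0∞)⁻¹ • ∑ i, Measure.dirac (y i)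
  rw [Equiv.sum_comp σ fun i => Measure.dirac (y i)]

/-- Two families of points with the same empirical measure agree up to a permutation. -/
lemma exists_perm_of_emp_eq [MeasurableSingletonClass E] {y y' : Fin N → E} (h : emp y = emp y') :
    ∃ σ : Equiv.Perm (Fin N), y' = y ∘ σ := by
  classical
  have hμ : empirical y = empirical y' := congrArg Subtype.val h
  have hN : (N : ℝ≥0∞)⁻¹ ≠ 0 := ENNReal.inv_ne_zero.2 (ENNReal.natCast_ne_top N)
  have hN' : (N : ℝ≥0∞)⁻¹ ≠ ∞ :=
    ENNReal.inv_ne_top.2 (Nat.cast_ne_zero.2 (NeZero.ne N))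
  have key : ∀ e : E, Fintype.card {i // y' i = e} = Fintype.card {i // y i = e} := by
    intro e
    have h1 := congrArg (fun ν : ProbabilityMeasure E => (ν : Measure E) {e}) hμ
    simp only [empirical_apply] at h1
    have h2 := (ENNReal.mul_right_inj hN hN').1 h1
    simp only [Measure.dirac_apply, Set.indicator_apply, Set.mem_singleton_iff, Pi.one_apply,
      Finset.sum_boole] at h2
    rw [Fintype.card_subtype, Fintype.card_subtype]
    exact_mod_cast h2.symm
  let σ : Equiv.Perm (Fin N) :=
    (Equiv.sigmaFiberEquiv y').symm.trans
      ((Equiv.sigmaCongrRight fun e => Fintype.equivOfCardEq (key e)).trans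
        (Equiv.sigmaFiberEquiv y))
  refine ⟨σ, funext fun i => ?_⟩
  exact ((Fintype.equivOfCardEq (key (y' i))) ⟨i, rfl⟩).2.symm

/-- Probability measures on a countably generated space are countably separated. -/
instance [MeasurableSpace.CountablyGenerated E] :
    MeasurableSpace.CountablySeparated (ProbabilityMeasure E) := by
  let B := MeasurableSpace.natGeneratingSequence E
  let C : Finset ℕ → Set E := fun I => ⋂ i ∈ I, B i
  have hC : ∀ I, MeasurableSet (C I) := fun I =>
    Finset.measurableSet_biInter _ fun i _ => MeasurableSpace.measurableSet_natGeneratingSequence i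
  let f : ProbabilityMeasure E → Finset ℕ → ℝ≥0∞ := fun μ I => (μ : Measure E) (C I)
  have hf : Measurable f := measurable_pi_lambda _ fun I =>
    (Measure.measurable_coe (hC I)).comp measurable_subtype_coe
  have hpi : IsPiSystem (Set.range C) := by
    rintro _ ⟨I, rfl⟩ _ ⟨J, rfl⟩ _
    refine ⟨I ∪ J, ?_⟩
    ext e
    simp only [C, Set.mem_iInter, Set.mem_inter_iff, Finset.mem_union]
    exact ⟨fun h => ⟨fun i hi => h i (Or.inl hi), fun i hi => h i (Or.inr hi)⟩,
      fun h i hi => hi.elim (h.1 i) (h.2 i)⟩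
  have hgen : (inferInstance : MeasurableSpace E) = MeasurableSpace.generateFrom (Set.range C) := by
    apply le_antisymm
    · conv_lhs => rw [← MeasurableSpace.generateFrom_natGeneratingSequence E]
      refine MeasurableSpace.generateFrom_mono ?_
      rintro _ ⟨n, rfl⟩
      exact ⟨{n}, by simp [C, B]⟩
    · refine MeasurableSpace.generateFrom_le ?_
      rintro _ ⟨I, rfl⟩
      exact hC I
  have hinj : Function.Injective f := by
    intro μ ν hμν
    have := μ.2
    have := ν.2
    apply Subtype.ext
    refine ext_of_generate_finite (Set.range C) hgen hpi ?_
      (measure_univ.trans measure_univ.symm)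
    rintro _ ⟨I, rfl⟩
    exact congrFun hμν I
  have hcg := MeasurableSpace.CountablyGenerated.comap (m := inferInstance) f
  have hsep : @MeasurableSpace.SeparatesPoints _ (MeasurableSpace.comap f inferInstance) := by
    refine @MeasurableSpace.SeparatesPoints.mk _ (_) fun μ ν h => hinj ?_
    by_contra hne
    obtain ⟨s, hs, h1, h2⟩ := MeasurableSpace.exists_measurableSet_of_ne hne
    exact h2 (h (f ⁻¹' s) ⟨s, hs, rfl⟩ h1)
  have := @MeasurableSpace.countablySeparated_of_separatesPoints _ (MeasurableSpace.comap f _)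
    hcg hsep
  exact MeasurableSpace.CountablySeparated.mono hf.comap_le

instance [MeasurableSpace.CountablyGenerated E] :
    MeasurableSpace.CountablySeparated (EmpiricalMeasures E N) :=
  MeasurableSpace.Subtype.countablySeparated

end Empirical

/-! ### The law of a Markov process and the discounted reward -/

section Markov

variable {X : Type*} [MeasurableSpace X]

/-- The law on the path space `X × X × ⋯` of the Markov process that starts in `x` and moves from
time `n` to time `n + 1` according to the transition kernel `P n` (Ionescu-Tulcea). -/
def pathLaw (P : ℕ → Kernel X X) [∀ n, IsMarkovKernel (P n)] (x : X) : Measure (ℕ → X) :=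
  Kernel.traj (X := fun _ => X)
    (fun n => (P n).comap (fun h : (Π _ : Finset.Iic n, X) => h ⟨n, Finset.mem_Iic.2 le_rfl⟩)
      (measurable_pi_apply _)) 0 (fun _ => x)

end Markov

/-! ### The data of the control problem -/

/-- The data of the mean-field control problem with state space `S`, action space `A` and
disturbance space `Z`, together with the standing requirements on them. -/
structure Model (S A Z : Type*) [MeasurableSpace S] [MeasurableSpace A] [MeasurableSpace Z] where
  /-- `adm x` is the set `D(x)` of actions that are available to an individual in state `x`. -/
  adm : S → Set A
  /-- The graph `D` of `x ↦ D(x)` is a measurable set. -/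
  measurableSet_graph : MeasurableSet {p : S × A | p.2 ∈ adm p.1}
  /-- `D` contains the graph of a measurable mapping. -/
  exists_selector : ∃ f : S → A, Measurable f ∧ ∀ x, f x ∈ adm x
  /-- The individual transition function `T(x, a, μ, z, z⁰)`. -/
  trans : S → A → ProbabilityMeasure S → Z → Z → S
  measurable_trans : Measurable fun p : S × A × ProbabilityMeasure S × Z × Z =>
    trans p.1 p.2.1 p.2.2.1 p.2.2.2.1 p.2.2.2.2
  /-- The individual one-stage reward `r(x, a, μ)`. -/
  reward : S → A → ProbabilityMeasure S → ℝ
  bounded_reward : ∃ C : ℝ, ∀ x a μ, |reward x a μ| ≤ C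
  /-- The distribution of the idiosyncratic disturbances. -/
  idioLaw : ProbabilityMeasure Z
  /-- The distribution of the common noise. -/
  commonLaw : ProbabilityMeasure Z
  /-- The discount factor. -/
  β : ℝ
  β_pos : 0 < β
  β_lt_one : β < 1

namespace Model

variable {S A Z : Type*} [MeasurableSpace S] [MeasurableSpace A] [MeasurableSpace Z]
  (M : Model S A Z)

/-- The set `D = {(x, a) | a ∈ D(x)}`. -/
def D : Set (S × A) := {p | p.2 ∈ M.adm p.1}

/-! #### The assumptions -/

/-- `D` is compact. -/
def A0 [TopologicalSpace S] [TopologicalSpace A] : Prop := IsCompact M.D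

/-- `x ↦ D(x)` is upper semicontinuous: if `xₙ → x` and `aₙ ∈ D(xₙ)`, then `(aₙ)` has an
accumulation point in `D(x)`. -/
def A1 [TopologicalSpace S] [TopologicalSpace A] : Prop :=
  ∀ (x : S) (u : ℕ → S) (a : ℕ → A), Tendsto u atTop (𝓝 x) → (∀ n, a n ∈ M.adm (u n)) →
    ∃ b ∈ M.adm x, MapClusterPt b atTop a

/-- `(x, a, μ) ↦ r(x, a, μ)` is upper semicontinuous (weak topology on probability measures). -/
def A2 [TopologicalSpace S] [OpensMeasurableSpace S] [TopologicalSpace A] : Prop :=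
  UpperSemicontinuous fun p : S × A × ProbabilityMeasure S => M.reward p.1 p.2.1 p.2.2

/-- `(x, a, μ) ↦ T(x, a, μ, z, z⁰)` is continuous for all `z, z⁰`. -/
def A3 [TopologicalSpace S] [OpensMeasurableSpace S] [TopologicalSpace A] : Prop :=
  ∀ z z₀ : Z, Continuous fun p : S × A × ProbabilityMeasure S => M.trans p.1 p.2.1 p.2.2 z z₀

/-! #### One step of the system -/

variable (N : ℕ)

/-- The law of `(Z¹, …, Zᴺ, Z⁰)`: all components are independent, `Z¹, …, Zᴺ` are identically
distributed. -/
def noise : Measure ((Fin N → Z) × Z) :=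
  (Measure.pi fun _ : Fin N => (M.idioLaw : Measure Z)).prod (M.commonLaw : Measure Z)

instance : IsProbabilityMeasure (M.noise N) := by unfold noise; infer_instance

variable {N}

/-- The law of the noise does not change when the individuals are renumbered. -/
lemma noise_map_perm (σ : Equiv.Perm (Fin N)) :
    (M.noise N).map (fun z => (z.1 ∘ σ, z.2)) = M.noise N := by
  have h := (measurePreserving_piCongrLeft (fun _ : Fin N => (M.idioLaw : Measure Z)) σ.symm)
  have h2 := (h.prod (MeasurePreserving.id (M.commonLaw : Measure Z))).map_eq
  unfold noise
  convert h2 using 2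
  funext z
  refine Prod.ext (funext fun i => ?_) rfl
  have := Equiv.piCongrLeft_apply_apply (fun _ : Fin N => Z) σ.symm z.1 (σ i)
  rw [Equiv.symm_apply_apply] at this
  exact this.symm

/-! #### The `N`-individual MDP on `S^N` -/

variable (N) in
/-- The set `F` of decision rules: measurable maps `f : S^N → A^N` with `f(x) ∈ D(x₁) × ⋯ × D(x_N)`
for all `x`. -/
def DecisionRule : Type _ :=
  {f : (Fin N → S) → (Fin N → A) // Measurable f ∧ ∀ x i, f x i ∈ M.adm (x i)}

variable {M} in
/-- The vector of the pairs `(xᵢ, f(x)ᵢ)`. -/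
def DecisionRule.pair (f : M.DecisionRule N) (x : Fin N → S) : Fin N → M.D :=
  fun i => ⟨(x i, f.1 x i), f.2.2 x i⟩

variable {M} in
lemma DecisionRule.measurable_pair (f : M.DecisionRule N) : Measurable f.pair :=
  measurable_pi_lambda _ fun i => Measurable.subtype_mk
    ((measurable_pi_apply i).prodMk ((measurable_pi_apply i).comp f.2.1))

variable [NeZero N]

/-- The transition function of the system. The pair `(x, a)` of a state vector and an admissible
action vector is given as the vector of the pairs `(xᵢ, aᵢ) ∈ D`. -/
def sysTrans (p : Fin N → M.D) (z : (Fin N → Z) × Z) : Fin N → S := fun i =>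
  M.trans (p i).1.1 (p i).1.2 (empirical fun j => (p j).1.1) (z.1 i) z.2

lemma measurable_sysTrans : Measurable (Function.uncurry (M.sysTrans (N := N))) := by
  refine measurable_pi_lambda _ fun i => ?_
  have h1 : Measurable fun q : (Fin N → M.D) × ((Fin N → Z) × Z) => (q.1 i : S × A) :=
    measurable_subtype_coe.comp ((measurable_pi_apply i).comp measurable_fst)
  have h2 : Measurable fun q : (Fin N → M.D) × ((Fin N → Z) × Z) =>
      (empirical fun j => (q.1 j).1.1 : ProbabilityMeasure S) :=
    measurable_empirical.comp (measurable_pi_lambda _ fun j =>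
      (measurable_fst.comp measurable_subtype_coe).comp
        ((measurable_pi_apply j).comp measurable_fst))
  have h3 : Measurable fun q : (Fin N → M.D) × ((Fin N → Z) × Z) => q.2.1 i :=
    (measurable_pi_apply i).comp (measurable_fst.comp measurable_snd)
  have h4 : Measurable fun q : (Fin N → M.D) × ((Fin N → Z) × Z) => q.2.2 :=
    measurable_snd.comp measurable_snd
  exact M.measurable_trans.comp
    ((measurable_fst.comp h1).prodMk ((measurable_snd.comp h1).prodMk (h2.prodMk (h3.prodMk h4))))

/-- The law of the next state vector when `p` is the current vector of states and actions. -/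
def sysKernel : Kernel (Fin N → M.D) (Fin N → S) where
  toFun p := (M.noise N).map (M.sysTrans p)
  measurable' := by
    have h : Measurable fun p : Fin N → M.D =>
        ((M.noise N).map (Prod.mk p)).map (Function.uncurry (M.sysTrans (N := N))) :=
      (Measure.measurable_map _ M.measurable_sysTrans).comp Measurable.map_prodMk_left
    convert h using 2 with p
    rw [Measure.map_map M.measurable_sysTrans measurable_prodMk_left]
    rfl

instance : IsMarkovKernel (M.sysKernel (N := N)) :=
  ⟨fun _ => Measure.isProbabilityMeasure_map
    (M.measurable_sysTrans.comp measurable_prodMk_left).aemeasurable⟩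

variable {M} in
/-- The transition kernel of the state process under the decision rule `f`. -/
def DecisionRule.kernel (f : M.DecisionRule N) : Kernel (Fin N → S) (Fin N → S) :=
  M.sysKernel.comap f.pair f.measurable_pair

instance (f : M.DecisionRule N) : IsMarkovKernel f.kernel := by
  unfold DecisionRule.kernel; infer_instance

/-- The expected discounted reward
`V_π(x) = (1/N) ∑ᵢ ∑ₖ β^k E_x^π[r(X_k^i, A_k^i, μ[X_k])]` of the policy `π = (f₀, f₁, …)`. -/
def policyValue (π : ℕ → M.DecisionRule N) (x : Fin N → S) : ℝ :=
  (N : ℝ)⁻¹ * ∑ i, ∑' k : ℕ, M.β ^ k *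
    ∫ ω, M.reward (ω k i) ((π k).1 (ω k) i) (empirical (ω k)) ∂pathLaw (fun n => (π n).kernel) x

/-- The value function `V^N(x) = sup_π V_π(x)`. -/
def value (x : Fin N → S) : ℝ := ⨆ π : ℕ → M.DecisionRule N, M.policyValue π x

/-! #### The mean-field MDP on `P_N(S)` -/

/-- The set `D̂(μ)` of the empirical measures on `D` of `(x, a)`, with `x ∈ S^N` such that
`μ[x] = μ` and `a ∈ D(x₁) × ⋯ × D(x_N)`. -/
def admHat (μ : EmpiricalMeasures S N) : Set (EmpiricalMeasures M.D N) :=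
  {Q | ∃ p : Fin N → M.D, (emp fun i => (p i).1.1) = μ ∧ Q = emp p}

variable (N) in
/-- The set `F̂` of decision rules: measurable maps `φ : P_N(S) → P_N(D)` with `φ(μ) ∈ D̂(μ)` for
all `μ`. -/
def DecisionRuleHat : Type _ :=
  {φ : EmpiricalMeasures S N → EmpiricalMeasures M.D N // Measurable φ ∧ ∀ μ, φ μ ∈ M.admHat μ}

/-- The one-stage reward `r̂(μ, Q) = ∫_D r(x, a, μ) Q(d(x, a))`. -/
def rewardHat (μ : EmpiricalMeasures S N) (Q : EmpiricalMeasures M.D N) : ℝ :=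
  ∫ p : M.D, M.reward p.1.1 p.1.2 μ.1 ∂(Q.1 : Measure M.D)

/-- The law of the empirical measure of the next state depends only on the empirical measure of the
current pairs of states and actions. -/
lemma sysKernel_map_emp_eq [MeasurableSingletonClass M.D] {p q : Fin N → M.D} (h : emp p = emp q) :
    (M.sysKernel p).map emp = (M.sysKernel q).map emp := by
  obtain ⟨σ, rfl⟩ := exists_perm_of_emp_eq h
  have hm : ∀ p : Fin N → M.D, Measurable (M.sysTrans p) := fun p =>
    M.measurable_sysTrans.comp measurable_prodMk_left
  have hσ : Measurable fun z : (Fin N → Z) × Z => (z.1 ∘ σ, z.2) :=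
    (measurable_pi_lambda _ fun i => (measurable_pi_apply (σ i)).comp measurable_fst).prodMk
      measurable_snd
  have hmean : empirical (fun j => ((p ∘ σ) j).1.1) = empirical fun j => (p j).1.1 :=
    congrArg Subtype.val (emp_comp_perm (fun j => (p j).1.1) σ)
  change ((M.noise N).map (M.sysTrans p)).map emp =
    ((M.noise N).map (M.sysTrans (p ∘ σ))).map emp
  rw [Measure.map_map measurable_emp (hm _), Measure.map_map measurable_emp (hm _)]
  conv_rhs => rw [← M.noise_map_perm σ]
  rw [Measure.map_map (measurable_emp.comp (hm _)) hσ]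
  congr 1
  funext z
  have hz : M.sysTrans (p ∘ σ) (z.1 ∘ σ, z.2) = M.sysTrans p z ∘ σ := by
    funext i
    simp only [sysTrans, hmean]
    rfl
  simp only [Function.comp_apply]
  rw [hz, emp_comp_perm]

variable [StandardBorelSpace S] [StandardBorelSpace A]

instance : StandardBorelSpace M.D := M.measurableSet_graph.standardBorel

/-- The transition law of the mean-field MDP: for `Q = μ[(x, a)]` it is the law of
`T̂(μ, Q, Z, Z⁰) = μ[T(x, a, μ[x], Z, Z⁰)]`, see `kernelHat_emp`; this law does not depend on the
numbering of the pairs in `(x, a)`. The measure `μ = μ[x]` is the first marginal of `Q`. -/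
def kernelHat : Kernel (EmpiricalMeasures M.D N) (EmpiricalMeasures S N) where
  toFun Q := (M.sysKernel (Function.surjInv emp_surjective Q)).map emp
  measurable' := by
    refine (measurable_emp.measurable_comp_iff_of_surjective emp_surjective).1 ?_
    have h : Measurable fun p : Fin N → M.D => (M.sysKernel p).map emp :=
      (Measure.measurable_map _ measurable_emp).comp M.sysKernel.measurable
    convert h using 2 with p
    exact M.sysKernel_map_emp_eq (Function.surjInv_eq emp_surjective _)

lemma kernelHat_emp (p : Fin N → M.D) :
    M.kernelHat (emp p) = (M.noise N).map fun z => emp (M.sysTrans p z) := by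
  have h : M.kernelHat (emp p) = (M.sysKernel p).map emp :=
    M.sysKernel_map_emp_eq (Function.surjInv_eq emp_surjective _)
  rw [h]
  exact Measure.map_map measurable_emp (M.measurable_sysTrans.comp measurable_prodMk_left)

instance : IsMarkovKernel (M.kernelHat (N := N)) :=
  ⟨fun _ => Measure.isProbabilityMeasure_map measurable_emp.aemeasurable⟩

variable {M} in
/-- The transition kernel of the process of empirical measures under the decision rule `φ`. -/
def DecisionRuleHat.kernel (φ : M.DecisionRuleHat N) :
    Kernel (EmpiricalMeasures S N) (EmpiricalMeasures S N) :=
  M.kernelHat.comap φ.1 φ.2.1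

instance (φ : M.DecisionRuleHat N) : IsMarkovKernel φ.kernel := by
  unfold DecisionRuleHat.kernel; infer_instance

/-- The expected discounted reward `J_ψ(μ) = ∑ₖ β^k E_μ^ψ[r̂(μ_k, φ_k(μ_k))]` of the policy
`ψ = (φ₀, φ₁, …)`. -/
def policyValueHat (ψ : ℕ → M.DecisionRuleHat N) (μ : EmpiricalMeasures S N) : ℝ :=
  ∑' k : ℕ, M.β ^ k *
    ∫ ω, M.rewardHat (ω k) ((ψ k).1 (ω k)) ∂pathLaw (fun n => (ψ n).kernel) μ

/-- The value function `J^N(μ) = sup_ψ J_ψ(μ)`. -/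
def valueHat (μ : EmpiricalMeasures S N) : ℝ :=
  ⨆ ψ : ℕ → M.DecisionRuleHat N, M.policyValueHat ψ μ

end Model

end MeanFieldMDP

end

open MeasureTheory ProbabilityTheory Filter Topology
open scoped ENNReal

noncomputable section

namespace MeanFieldMDP

/-! ### Measurable selections -/

section Selection

/-! Two facts are combined: everything that matters is invariant under renumbering the individuals,
and finite-horizon optimal rules can be chosen to depend on empirical measures only. For `J ≤ V`,
represent the action `φ (emp x)` measurably by a vector of pairs and permute it so that its states
are `x`; the resulting actions form a rule `f` that induces `φ` (`exists_induces`). Since the noise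
is exchangeable, `emp` carries the kernel of `f` to that of `φ`, hence the one-time marginals to
each other, and the two policies have equal value (`policyValueHat_emp_eq`). For `V ≤ J`, an
arbitrary policy need not be symmetric and need not induce a mean-field policy. Rewards are shifted
by a bound `C` to become nonnegative, and a finite horizon is solved by backward induction.
Compactness of `D` and semicontinuity make each `valueIter` upper semicontinuous and give measurable
maximizers (`exists_measurable_argmax`). Each `valueIter` is also permutation invariant, so applying
a maximizer to one representative of each empirical measure preserves optimality and yields an
induced rule (`exists_optimal_rule`). Thus on every finite horizon any policy is matched by an
induced one (`exists_induces_sum_le`). Nonnegativity bounds that finite sum by the full shifted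
value of the induced policy, hence by the shifted `J`; then the horizon tends to infinity. No
infinite-horizon optimality equation is needed. -/

/-- A measurable selection among countably many measurable functions. -/
lemma exists_measurable_choice {ι X Y : Type*} [Countable ι] [MeasurableSpace X]
    [MeasurableSpace Y] {g : ι → X → Y} (hg : ∀ i, Measurable (g i)) {B : ι → Set X}
    (hB : ∀ i, MeasurableSet (B i)) (hcov : ∀ x, ∃ i, x ∈ B i) :
    ∃ f : X → Y, Measurable f ∧ ∀ x, ∃ i, x ∈ B i ∧ f x = g i x := by
  classical
  rcases isEmpty_or_nonempty ι with hι | hι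
  · have : IsEmpty X := ⟨fun x => hι.elim (hcov x).choose⟩
    exact ⟨isEmptyElim, measurable_of_empty _, isEmptyElim⟩
  obtain ⟨e, he⟩ := exists_surjective_nat ι
  have h : ∀ x, ∃ n, x ∈ B (e n) := fun x => by
    obtain ⟨i, hi⟩ := hcov x
    obtain ⟨n, rfl⟩ := he i
    exact ⟨n, hi⟩
  exact ⟨fun x => g (e (Nat.find (h x))) x,
    Measurable.find (f := fun n => g (e n)) (p := fun n x => x ∈ B (e n)) (fun n => hg (e n))
      (fun n => hB (e n)) h,
    fun x => ⟨_, Nat.find_spec (h x), rfl⟩⟩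

/-- The supremum of `g` over the points of `F` above `x`. -/
def fiberSup {K X : Type*} (F : Set K) (π : K → X) (g : K → ℝ≥0∞) (x : X) : ℝ≥0∞ :=
  ⨆ p ∈ {p | p ∈ F ∧ π p = x}, g p

variable {K X : Type*} [TopologicalSpace K] [CompactSpace K] [TopologicalSpace X] [T2Space X]
  {π : K → X} {g : K → ℝ≥0∞}

lemma exists_eq_fiberSup {F : Set K} (hF : IsClosed F) (hπ : Continuous π)
    (hg : UpperSemicontinuous g) {x : X} (hx : ∃ p ∈ F, π p = x) :
    ∃ p ∈ F, π p = x ∧ g p = fiberSup F π g x := by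
  have hc : IsCompact {p | p ∈ F ∧ π p = x} :=
    (hF.inter (isClosed_singleton.preimage hπ)).isCompact
  obtain ⟨p, hp, hmax⟩ := UpperSemicontinuousOn.exists_isMaxOn hx hc (hg.upperSemicontinuousOn _)
  exact ⟨p, hp.1, hp.2, le_antisymm (le_iSup₂_of_le p hp le_rfl) (iSup₂_le fun q hq => hmax hq)⟩

/-- Maxima over nonempty fibers are attained, so a superlevel set of the supremum is the image of a
closed, hence compact, superlevel set of `g` in `F`. -/
lemma upperSemicontinuous_fiberSup {F : Set K} (hF : IsClosed F) (hπ : Continuous π)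
    (hg : UpperSemicontinuous g) : UpperSemicontinuous (fiberSup F π g) := by
  refine upperSemicontinuous_iff_isClosed_preimage.2 fun c => ?_
  -- The supremum over an empty fiber is `0`; only for `c ≠ 0` does the superlevel set consist of
  -- points with nonempty fiber.
  rcases eq_or_ne c 0 with rfl | hc
  · simp
  have : fiberSup F π g ⁻¹' Set.Ici c = π '' (F ∩ g ⁻¹' Set.Ici c) := by
    ext x
    constructor
    · intro hx
      by_cases h : ∃ p ∈ F, π p = x
      · obtain ⟨p, hp, hpx, hgp⟩ := exists_eq_fiberSup hF hπ hg h
        exact ⟨p, ⟨hp, by rw [Set.mem_preimage, hgp]; exact hx⟩, hpx⟩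
      · refine absurd (le_antisymm ((Set.mem_Ici.1 hx).trans ?_) zero_le) hc
        exact iSup₂_le fun p hp => absurd ⟨p, hp⟩ h
    · rintro ⟨p, ⟨hp, hgp⟩, rfl⟩
      exact (Set.mem_Ici.1 hgp).trans (le_iSup₂_of_le (f := fun q _ => g q) p ⟨hp, rfl⟩ le_rfl)
  rw [this]
  exact ((hF.inter (hg.isClosed_preimage c)).isCompact.image hπ).isClosed

/-- An upper semicontinuous function on a compact subset of the line has a measurable selection
of maximizers over the fibers of a continuous map. -/
lemma exists_measurable_argmax_real {s : Set ℝ} (hs : IsCompact s) [MeasurableSpace X]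
    [BorelSpace X] {π : s → X} {g : s → ℝ≥0∞} (hπ : Continuous π) (hsurj : Function.Surjective π)
    (hg : UpperSemicontinuous g) :
    ∃ k : X → s, Measurable k ∧ ∀ x, π (k x) = x ∧ g (k x) = fiberSup Set.univ π g x := by
  have : CompactSpace s := isCompact_iff_compactSpace.1 hs
  let v := fiberSup Set.univ π g
  -- The order of the line singles out the least maximizer, whose sublevel sets are expressible by
  -- fiber suprema.
  have hleast : ∀ x, ∃ k : s, IsLeast {p : s | π p = x ∧ v x ≤ g p} k := fun x => by
    refine IsCompact.exists_isLeast ?_ ?_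
    · exact ((isClosed_singleton.preimage hπ).inter (hg.isClosed_preimage (v x))).isCompact
    · obtain ⟨p, -, h1, h2⟩ := exists_eq_fiberSup isClosed_univ hπ hg
        ((hsurj x).imp fun p hp => ⟨trivial, hp⟩)
      exact ⟨p, h1, h2.ge⟩
  choose k hk using hleast
  refine ⟨k, ?_, fun x => ⟨(hk x).1.1, le_antisymm ?_ (hk x).1.2⟩⟩
  · suffices Measurable fun x => (k x : ℝ) from this.subtype_mk
    refine measurable_of_Iic fun t => ?_
    have hcl : IsClosed {p : s | (p : ℝ) ≤ t} := isClosed_Iic.preimage continuous_subtype_val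
    -- `k x ≤ t` means that the part of the fiber below `t` is nonempty and already attains the full
    -- supremum. Nonemptiness must be required separately: if `v x = 0`, an empty part has the same
    -- supremum.
    have h1 : MeasurableSet (π '' {p : s | (p : ℝ) ≤ t}) :=
      (hcl.isCompact.image hπ).isClosed.measurableSet
    have h2 : MeasurableSet {x | v x ≤ fiberSup {p : s | (p : ℝ) ≤ t} π g x} :=
      measurableSet_le (upperSemicontinuous_fiberSup isClosed_univ hπ hg).measurable
        (upperSemicontinuous_fiberSup hcl hπ hg).measurable
    convert h1.inter h2 using 1
    ext x
    constructor
    · intro hx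
      exact ⟨⟨k x, hx, (hk x).1.1⟩,
        (hk x).1.2.trans (le_iSup₂_of_le (k x) ⟨hx, (hk x).1.1⟩ le_rfl)⟩
    · rintro ⟨⟨p, hp, hpx⟩, hx⟩
      obtain ⟨q, hq, hqx, hgq⟩ := exists_eq_fiberSup hcl hπ hg ⟨p, hp, hpx⟩
      have hle : k x ≤ q := (hk x).2 ⟨hqx, (Set.mem_ofPred.1 hx).trans hgq.ge⟩
      exact (Subtype.coe_le_coe.2 hle).trans hq
  · exact le_iSup₂_of_le (k x) ⟨trivial, (hk x).1.1⟩ le_rfl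

/-- **Measurable selection of maximizers** of an upper semicontinuous function over the fibers of
a continuous surjection from a compact metrizable space. -/
theorem exists_measurable_argmax [TopologicalSpace.MetrizableSpace K] [Nonempty K]
    [MeasurableSpace K] [BorelSpace K] [MeasurableSpace X] [BorelSpace X]
    (hπ : Continuous π) (hsurj : Function.Surjective π) (hg : UpperSemicontinuous g) :
    ∃ f : X → K, Measurable f ∧ ∀ x, π (f x) = x ∧ g (f x) = fiberSup Set.univ π g x := by
  let := TopologicalSpace.metrizableSpaceMetric K
  -- A nonempty compact metrizable space is a continuous image of the Cantor set, which reduces the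
  -- selection to a compact subset of the line; surjectivity of `d` leaves the fiber suprema
  -- unchanged.
  obtain ⟨c, hc, hcs⟩ := exists_nat_bool_continuous_surjective_of_compact K
  let d : cantorSet → K := c ∘ cantorSetHomeomorphNatToBool
  have hd : Continuous d := hc.comp cantorSetHomeomorphNatToBool.continuous
  have hds : Function.Surjective d := hcs.comp cantorSetHomeomorphNatToBool.surjective
  obtain ⟨k, hk, hkx⟩ := exists_measurable_argmax_real isCompact_cantorSet (hπ.comp hd)
    (hsurj.comp hds) (g := g ∘ d) (hg.comp hd)
  refine ⟨d ∘ k, hd.measurable.comp hk, fun x => ⟨(hkx x).1, ((hkx x).2).trans ?_⟩⟩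
  apply le_antisymm
  · exact iSup₂_le fun p hp => le_iSup₂_of_le (d p) ⟨trivial, hp.2⟩ le_rfl
  · refine iSup₂_le fun p hp => ?_
    obtain ⟨q, rfl⟩ := hds p
    exact le_iSup₂_of_le q ⟨trivial, hp.2⟩ le_rfl

/-- Upper semicontinuity of parametric integrals. -/
lemma upperSemicontinuous_lintegral {P Ω : Type*} [TopologicalSpace P] [FirstCountableTopology P]
    [MeasurableSpace Ω] {μ : Measure Ω} [IsFiniteMeasure μ] {F : P → Ω → ℝ≥0∞}
    (hF : ∀ ω, UpperSemicontinuous fun p => F p ω) (hm : ∀ p, Measurable (F p)) {B : ℝ≥0∞}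
    (hB : B ≠ ∞) (hFB : ∀ p ω, F p ω ≤ B) : UpperSemicontinuous fun p => ∫⁻ ω, F p ω ∂μ := by
  -- First countability allows testing closedness along sequences, where the claim is the reverse
  -- Fatou lemma with the constant majorant `B`.
  refine upperSemicontinuous_iff_isClosed_preimage.2 fun c => IsSeqClosed.isClosed ?_
  intro u p hu hup
  calc c ≤ limsup (fun n => ∫⁻ ω, F (u n) ω ∂μ) atTop :=
        le_limsup_of_frequently_le (Frequently.of_forall hu)
    _ ≤ ∫⁻ ω, limsup (fun n => F (u n) ω) atTop ∂μ :=
        limsup_lintegral_le (fun _ => B) (fun n => hm _) (fun n => ae_of_all _ (hFB _))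
          (by simpa using ENNReal.mul_ne_top hB (measure_ne_top μ _))
    _ ≤ ∫⁻ ω, F p ω ∂μ := lintegral_mono fun ω =>
        (limsup_le_limsup_of_le (u := fun q => F q ω) hup).trans ((hF ω).limsup_le p)

end Selection

/-! ### Measurable representatives of empirical measures -/

section Representatives

variable {E : Type*} [MeasurableSpace E] [StandardBorelSpace E] {N : ℕ} [NeZero N]

/-- The empirical measures have representing vectors that depend measurably on them. -/
lemma exists_measurable_rightInverse_emp :
    ∃ s : EmpiricalMeasures E N → (Fin N → E), Measurable s ∧ ∀ μ, emp (s μ) = μ := by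
  let e : E → ℝ := embeddingReal E
  have he : MeasurableEmbedding e := measurableEmbedding_embeddingReal E
  -- `f` sorts a vector along the Borel embedding `e` into the line, so it depends only on the
  -- multiset of entries.
  obtain ⟨f, hf, hfσ⟩ := exists_measurable_choice (ι := Equiv.Perm (Fin N))
    (g := fun σ (y : Fin N → E) => y ∘ σ) (B := fun σ => {y | Monotone (e ∘ y ∘ σ)})
    (fun σ => measurable_pi_lambda _ fun i => measurable_pi_apply _)
    (fun σ => by
      simp only [Monotone, Set.ofPred_forall]
      refine MeasurableSet.iInter fun i => MeasurableSet.iInter fun j => MeasurableSet.iInter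
        fun _ => measurableSet_le ?_ ?_ <;>
      exact he.measurable.comp (measurable_pi_apply _))
    (fun y => ⟨Tuple.sort (e ∘ y), Tuple.monotone_sort (e ∘ y)⟩)
  have hperm : ∀ y (τ : Equiv.Perm (Fin N)), f (y ∘ τ) = f y := fun y τ => by
    obtain ⟨σ, hσ, h⟩ := hfσ y
    obtain ⟨σ', hσ', h'⟩ := hfσ (y ∘ τ)
    rw [h, h']
    refine he.injective.comp_left ?_
    exact Tuple.unique_monotone (f := e ∘ y) (σ := σ'.trans τ) hσ' hσ
  refine ⟨fun μ => f (Function.surjInv emp_surjective μ), ?_, fun μ => ?_⟩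
  -- Measurability descends along a measurable surjection from a standard Borel space onto a
  -- countably separated one, so it suffices that the composition with `emp` is `f`.
  · refine (measurable_emp.measurable_comp_iff_of_surjective emp_surjective).1 ?_
    convert hf using 1
    funext y
    obtain ⟨σ, h⟩ := exists_perm_of_emp_eq (Function.surjInv_eq emp_surjective (emp y))
    have := hperm (Function.surjInv emp_surjective (emp y)) σ
    rw [← h] at this
    exact this.symm
  · obtain ⟨σ, -, h⟩ := hfσ (Function.surjInv emp_surjective μ)
    change emp (f _) = μ
    rw [h, emp_comp_perm, Function.surjInv_eq emp_surjective]

end Representatives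

/-! ### Marginals of Markov processes -/

section Markov

open Preorder

variable {X : Type*} [MeasurableSpace X] (P : ℕ → Kernel X X) [∀ n, IsMarkovKernel (P n)] (x : X)

instance : IsProbabilityMeasure (pathLaw P x) := by unfold pathLaw; infer_instance

lemma pathLaw_map_zero : (pathLaw P x).map (fun ω => ω 0) = Measure.dirac x := by
  let κ : (n : ℕ) → Kernel (Π _ : Finset.Iic n, X) X := fun n =>
    (P n).comap (fun h => h ⟨n, Finset.mem_Iic.2 le_rfl⟩) (measurable_pi_apply _)
  have h : (pathLaw P x).map (frestrictLe 0) = _ :=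
    Kernel.traj_map_frestrictLe_apply (X := fun _ => X) (κ := κ) 0 0 (fun _ => x)
  rw [Kernel.partialTraj_self, Kernel.id_apply] at h
  let e : (Π _ : Finset.Iic 0, X) → X := fun y => y ⟨0, Finset.mem_Iic.2 le_rfl⟩
  have he : Measurable e := measurable_pi_apply _
  have h2 : (pathLaw P x).map (e ∘ frestrictLe (π := fun _ => X) 0) = _ :=
    (Measure.map_map he (measurable_frestrictLe 0)).symm.trans (congrArg (Measure.map e) h)
  exact h2.trans (Measure.map_dirac' he _)

/-- The rewards involve only one-time marginals; together with `pathLaw_map_zero` this recursion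
determines them. -/
lemma pathLaw_map_succ (k : ℕ) : (pathLaw P x).map (fun ω => ω (k + 1)) =
    ((pathLaw P x).map fun ω => ω k).bind (P k) := by
  let κ : (n : ℕ) → Kernel (Π _ : Finset.Iic n, X) X := fun n =>
    (P n).comap (fun h => h ⟨n, Finset.mem_Iic.2 le_rfl⟩) (measurable_pi_apply _)
  have h1 : (Kernel.traj (X := fun _ => X) κ 0).map (fun ω => ω (k + 1)) =
      κ k ∘ₖ (Kernel.traj (X := fun _ => X) κ 0).map (frestrictLe k) := by
    conv_lhs => rw [← Kernel.traj_comp_partialTraj (X := fun _ => X) (κ := κ) (Nat.zero_le k)]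
    rw [Kernel.map_comp, Kernel.map_traj_succ_self, Kernel.traj_map_frestrictLe]
  have h2 := DFunLike.congr_fun h1 (fun _ => x)
  rw [Kernel.map_apply _ (measurable_pi_apply _), Kernel.comp_apply,
    Kernel.map_apply _ (measurable_frestrictLe k)] at h2
  refine h2.trans ?_
  ext s hs
  have hk : Measurable fun ω : ℕ → X => ω k := measurable_pi_apply k
  rw [Measure.bind_apply hs (Kernel.aemeasurable _), Measure.bind_apply hs (Kernel.aemeasurable _),
    lintegral_map ((P k).measurable_coe hs) hk,
    lintegral_map ((κ k).measurable_coe hs) (measurable_frestrictLe k)]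
  rfl

variable {P x}

lemma lintegral_pathLaw_zero {w : X → ℝ≥0∞} (hw : Measurable w) :
    ∫⁻ ω, w (ω 0) ∂pathLaw P x = w x := by
  rw [← lintegral_map hw (measurable_pi_apply 0), pathLaw_map_zero, lintegral_dirac' _ hw]

lemma lintegral_pathLaw_succ {w : X → ℝ≥0∞} (hw : Measurable w) (k : ℕ) :
    ∫⁻ ω, w (ω (k + 1)) ∂pathLaw P x = ∫⁻ ω, ∫⁻ y, w y ∂P k (ω k) ∂pathLaw P x := by
  rw [← lintegral_map hw (measurable_pi_apply (k + 1)), pathLaw_map_succ,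
    Measure.lintegral_bind (Kernel.aemeasurable _) hw.aemeasurable,
    lintegral_map hw.lintegral_kernel (measurable_pi_apply k)]

variable {ρ w : ℕ → X → ℝ≥0∞} {b : ℝ≥0∞} {n : ℕ}

lemma lintegral_pathLaw_add (hρ : ∀ k, Measurable (ρ k)) (hw : ∀ k, Measurable (w k)) (k : ℕ) :
    ∫⁻ ω, (ρ k (ω k) + b * ∫⁻ y, w (k + 1) y ∂P k (ω k)) ∂pathLaw P x =
      ∫⁻ ω, ρ k (ω k) ∂pathLaw P x + b * ∫⁻ ω, w (k + 1) (ω (k + 1)) ∂pathLaw P x := by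
  have hk : Measurable fun ω : ℕ → X => ω k := measurable_pi_apply k
  have hρk : Measurable fun ω : ℕ → X => ρ k (ω k) := (hρ k).comp hk
  refine (lintegral_add_left hρk _).trans ?_
  have hwk : Measurable fun ω : ℕ → X => ∫⁻ y, w (k + 1) y ∂P k (ω k) :=
    (hw (k + 1)).lintegral_kernel.comp hk
  rw [lintegral_const_mul _ hwk, lintegral_pathLaw_succ (hw _)]

/-- Backward induction: a supersolution of the optimality inequality dominates the discounted
rewards up to a finite horizon. -/
lemma sum_lintegral_pathLaw_le (hρ : ∀ k, Measurable (ρ k)) (hw : ∀ k, Measurable (w k))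
    (h : ∀ k < n, ∀ y, ρ k y + b * ∫⁻ z, w (k + 1) z ∂P k y ≤ w k y) :
    ∑ k ∈ Finset.range n, b ^ k * ∫⁻ ω, ρ k (ω k) ∂pathLaw P x +
      b ^ n * ∫⁻ ω, w n (ω n) ∂pathLaw P x ≤ w 0 x := by
  induction n with
  | zero => simp [lintegral_pathLaw_zero (hw 0)]
  | succ n ih =>
    refine le_trans ?_ (ih fun k hk => h k (hk.trans n.lt_succ_self))
    -- The last reward and the terminal term regroup into the expectation of the one-step expression
    -- at time `n`, to which the hypothesis applies.
    rw [Finset.sum_range_succ, add_assoc, pow_succ, mul_assoc, ← mul_add,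
      ← lintegral_pathLaw_add hρ hw]
    gcongr with ω
    exact h n n.lt_succ_self _

/-- Backward induction: a subsolution of the optimality inequality is dominated by the discounted
rewards up to a finite horizon and the terminal value. -/
lemma le_sum_lintegral_pathLaw (hρ : ∀ k, Measurable (ρ k)) (hw : ∀ k, Measurable (w k))
    (h : ∀ k < n, ∀ y, w k y ≤ ρ k y + b * ∫⁻ z, w (k + 1) z ∂P k y) :
    w 0 x ≤ ∑ k ∈ Finset.range n, b ^ k * ∫⁻ ω, ρ k (ω k) ∂pathLaw P x +
      b ^ n * ∫⁻ ω, w n (ω n) ∂pathLaw P x := by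
  induction n with
  | zero => simp [lintegral_pathLaw_zero (hw 0)]
  | succ n ih =>
    refine (ih fun k hk => h k (hk.trans n.lt_succ_self)).trans ?_
    rw [Finset.sum_range_succ, add_assoc, pow_succ, mul_assoc, ← mul_add,
      ← lintegral_pathLaw_add hρ hw]
    gcongr with ω
    exact h n n.lt_succ_self _

/-- If `F` maps the transition kernels `P n` to `P' n`, then it maps the marginals of the one
process to the marginals of the other. -/
lemma pathLaw_map_eval_map {Y : Type*} [MeasurableSpace Y] {P' : ℕ → Kernel Y Y}
    [∀ n, IsMarkovKernel (P' n)] {F : X → Y} (hF : Measurable F)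
    (h : ∀ n y, (P n y).map F = P' n (F y)) (k : ℕ) :
    (pathLaw P x).map (fun ω => F (ω k)) = (pathLaw P' (F x)).map fun ω => ω k := by
  have hk : ∀ k, Measurable fun ω : ℕ → X => ω k := fun k => measurable_pi_apply k
  have hmap : ∀ k, (pathLaw P x).map (fun ω => F (ω k)) =
      ((pathLaw P x).map fun ω => ω k).map F := fun k => (Measure.map_map hF (hk k)).symm
  induction k with
  | zero => rw [hmap, pathLaw_map_zero, pathLaw_map_zero, Measure.map_dirac' hF]
  | succ k ih =>
    rw [hmap] at ih
    rw [hmap, pathLaw_map_succ, pathLaw_map_succ, ← ih]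
    ext s hs
    rw [Measure.map_apply hF hs, Measure.bind_apply (hF hs) (Kernel.aemeasurable _),
      Measure.bind_apply hs (Kernel.aemeasurable _), lintegral_map ((P' k).measurable_coe hs) hF]
    refine lintegral_congr fun y => ?_
    rw [← h, Measure.map_apply hF hs]

end Markov

/-! ### Weak continuity of the empirical measure -/

lemma continuous_empirical {E : Type*} [MeasurableSpace E] [TopologicalSpace E]
    [OpensMeasurableSpace E] {N : ℕ} [NeZero N] :
    Continuous (empirical : (Fin N → E) → ProbabilityMeasure E) := by
  refine continuous_iff_continuousAt.2 fun y =>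
    ProbabilityMeasure.tendsto_iff_forall_lintegral_tendsto.2 fun f => ?_
  have hf : Measurable fun e => (f e : ℝ≥0∞) :=
    (measurable_coe_nnreal_ennreal).comp f.continuous.measurable
  have h : ∀ y : Fin N → E, ∫⁻ e, f e ∂(empirical y : Measure E) =
      (N : ℝ≥0∞)⁻¹ * ∑ i, (f (y i) : ℝ≥0∞) := fun y => by
    simp only [empirical, ProbabilityMeasure.coe_mk, lintegral_smul_measure,
      lintegral_finsetSum_measure, lintegral_dirac' _ hf, smul_eq_mul]
  simp only [h]
  refine Continuous.continuousAt (f := fun y : Fin N → E =>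
    (N : ℝ≥0∞)⁻¹ * ∑ i, (f (y i) : ℝ≥0∞)) ?_
  refine ENNReal.continuous_const_mul (ENNReal.inv_ne_top.2 (Nat.cast_ne_zero.2 (NeZero.ne N)))
    |>.comp (continuous_finsetSum _ fun i _ => ?_)
  exact ENNReal.continuous_coe.comp (f.continuous.comp (continuous_apply i))

namespace Model

variable {S A Z : Type*} [MeasurableSpace S] [MeasurableSpace A] [MeasurableSpace Z]
  (M : Model S A Z) {N : ℕ}

/-- The state vector that belongs to a vector of states and actions. -/
def statesOf (p : Fin N → M.D) : Fin N → S := fun i => (p i).1.1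

lemma statesOf_surjective : Function.Surjective (M.statesOf (N := N)) := fun x => by
  obtain ⟨f, -, hf⟩ := M.exists_selector
  exact ⟨fun i => ⟨(x i, f (x i)), hf (x i)⟩, rfl⟩

variable {M} in
lemma continuous_statesOf [TopologicalSpace S] [TopologicalSpace A] :
    Continuous (M.statesOf (N := N)) :=
  continuous_pi fun i => continuous_fst.comp (continuous_subtype_val.comp (continuous_apply i))

variable [NeZero N]

/-! ### The average reward -/

/-- The average one-stage reward of the individuals. -/
def meanReward (p : Fin N → M.D) : ℝ :=
  (N : ℝ)⁻¹ * ∑ i, M.reward (p i).1.1 (p i).1.2 (empirical fun j => (p j).1.1)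

variable {M} in
lemma abs_meanReward_le {C : ℝ} (hC : ∀ x a μ, |M.reward x a μ| ≤ C) (p : Fin N → M.D) :
    |M.meanReward p| ≤ C := by
  have hN : (0 : ℝ) < N := Nat.cast_pos.2 (NeZero.pos N)
  rw [meanReward, abs_mul, abs_of_pos (inv_pos.2 hN), inv_mul_le_iff₀ hN]
  calc _ ≤ ∑ i : Fin N, |M.reward (p i).1.1 (p i).1.2 (empirical fun j => (p j).1.1)| :=
        Finset.abs_sum_le_sum_abs _ _
    _ ≤ ∑ _i : Fin N, C := Finset.sum_le_sum fun i _ => hC _ _ _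
    _ = N * C := by simp

lemma empirical_fst_comp (p : Fin N → M.D) (σ : Equiv.Perm (Fin N)) :
    (empirical fun j => ((p ∘ σ) j).1.1) = empirical fun j => (p j).1.1 :=
  congrArg Subtype.val (emp_comp_perm (fun j => (p j).1.1) σ)

lemma meanReward_comp_perm (p : Fin N → M.D) (σ : Equiv.Perm (Fin N)) :
    M.meanReward (p ∘ σ) = M.meanReward p := by
  rw [meanReward, meanReward, empirical_fst_comp]
  congr 1
  exact Equiv.sum_comp σ fun i => M.reward (p i).1.1 (p i).1.2 (empirical fun j => (p j).1.1)

lemma rewardHat_emp [MeasurableSingletonClass M.D] (p : Fin N → M.D) :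
    M.rewardHat (emp fun i => (p i).1.1) (emp p) = M.meanReward p := by
  simp only [rewardHat, emp, empirical, ProbabilityMeasure.coe_mk, integral_smul_measure]
  rw [integral_finsetSum_measure fun i _ => integrable_dirac (by simp)]
  simp [meanReward, empirical]

/-! ### Decision rules -/

section Rules

instance : Nonempty (M.DecisionRule N) := by
  obtain ⟨f, hf, hfD⟩ := M.exists_selector
  exact ⟨⟨fun x i => f (x i), measurable_pi_lambda _ fun i => hf.comp (measurable_pi_apply i),
    fun x i => hfD (x i)⟩⟩

variable [StandardBorelSpace S]

/-- A decision rule of the individuals gives a decision rule of the mean-field if it is applied to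
suitable representatives of the empirical measures. -/
lemma exists_decisionRuleHat (f : M.DecisionRule N) :
    ∃ φ : M.DecisionRuleHat N, ∀ x, ∃ σ : Equiv.Perm (Fin N),
      φ.1 (emp x) = emp (f.pair (x ∘ σ)) := by
  -- `f` need not commute with permutations, so a fixed representative `s μ` must be chosen; it
  -- agrees with a given `x` only up to some `σ` depending on `x`.
  obtain ⟨s, hs, hse⟩ := exists_measurable_rightInverse_emp (E := S) (N := N)
  refine ⟨⟨fun μ => emp (f.pair (s μ)), measurable_emp.comp (f.measurable_pair.comp hs),
    fun μ => ⟨f.pair (s μ), hse μ, rfl⟩⟩, fun x => ?_⟩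
  obtain ⟨σ, hσ⟩ := exists_perm_of_emp_eq (hse (emp x)).symm
  exact ⟨σ, by rw [← hσ]⟩

instance : Nonempty (M.DecisionRuleHat N) :=
  (M.exists_decisionRuleHat (Classical.arbitrary (M.DecisionRule N))).nonempty

variable [StandardBorelSpace A]

variable {M} in
/-- The decision rule `f` of the individuals induces the decision rule `φ` of the mean-field. -/
def DecisionRule.Induces (f : M.DecisionRule N) (φ : M.DecisionRuleHat N) : Prop :=
  ∀ x, emp (f.pair x) = φ.1 (emp x)

/-- Every decision rule of the mean-field is induced by a decision rule of the individuals. -/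
lemma exists_induces (φ : M.DecisionRuleHat N) : ∃ f : M.DecisionRule N, f.Induces φ := by
  obtain ⟨s, hs, hse⟩ := exists_measurable_rightInverse_emp (E := M.D) (N := N)
  let q : (Fin N → S) → (Fin N → M.D) := fun x => s (φ.1 (emp x))
  have hq : Measurable q := hs.comp (φ.2.1.comp measurable_emp)
  -- Admissibility provides some vector `p` of pairs with state measure `emp x` and empirical
  -- measure `φ (emp x)`; `q x` is a permutation of `p`.
  have hfst : ∀ x, (emp fun i => (q x i).1.1) = emp x := fun x => by
    obtain ⟨p, hp, hQ⟩ := φ.2.2 (emp x)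
    obtain ⟨σ, hσ⟩ := exists_perm_of_emp_eq (hQ.symm.trans (hse (φ.1 (emp x))).symm)
    rw [← hp, ← emp_comp_perm (fun i => (p i).1.1) σ]
    congr 1
    funext i
    exact congrArg (fun p : M.D => p.1.1) (congrFun hσ i)
  have hqi : ∀ i, Measurable fun x => ((q x i : M.D) : S × A) := fun i =>
    measurable_subtype_coe.comp ((measurable_pi_apply i).comp hq)
  -- For each of the finitely many `σ`, the points where `σ` aligns the states of `q x` with `x`
  -- form a measurable set; there the actions are permuted by `σ`.
  obtain ⟨f, hf, hfσ⟩ := exists_measurable_choice (ι := Equiv.Perm (Fin N))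
    (g := fun σ x i => (q x (σ i)).1.2) (B := fun σ => {x | ∀ i, (q x (σ i)).1.1 = x i})
    (fun σ => measurable_pi_lambda _ fun i => measurable_snd.comp (hqi (σ i)))
    (fun σ => by
      simp only [Set.ofPred_forall]
      exact MeasurableSet.iInter fun i => measurableSet_eq_fun
        (measurable_fst.comp (hqi (σ i))) (measurable_pi_apply i))
    (fun x => by
      obtain ⟨σ, hσ⟩ := exists_perm_of_emp_eq (hfst x)
      exact ⟨σ, fun i => (congrFun hσ i).symm⟩)
  have hpair : ∀ x, ∃ σ : Equiv.Perm (Fin N), ∀ i, (x i, f x i) = (q x (σ i)).1 := fun x => by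
    obtain ⟨σ, hσ, h⟩ := hfσ x
    exact ⟨σ, fun i => Prod.ext (hσ i).symm (congrFun h i)⟩
  have hfD : ∀ x i, f x i ∈ M.adm (x i) := fun x i => by
    obtain ⟨σ, hσ⟩ := hpair x
    have : (x i, f x i) ∈ M.D := hσ i ▸ (q x (σ i)).2
    exact this
  refine ⟨⟨f, hf, hfD⟩, fun x => ?_⟩
  obtain ⟨σ, hσ⟩ := hpair x
  have : DecisionRule.pair (M := M) ⟨f, hf, hfD⟩ x = q x ∘ σ :=
    funext fun i => Subtype.ext (hσ i)
  rw [this, emp_comp_perm, hse]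

variable {M} in
lemma DecisionRule.Induces.kernel_map {f : M.DecisionRule N} {φ : M.DecisionRuleHat N}
    (h : f.Induces φ) (x : Fin N → S) : (f.kernel x).map emp = φ.kernel (emp x) := by
  change (M.sysKernel (f.pair x)).map emp = M.kernelHat (φ.1 (emp x))
  rw [← h x]
  exact M.sysKernel_map_emp_eq (Function.surjInv_eq emp_surjective _).symm

end Rules

/-! ### Policy values -/

section Values

variable {M} in
lemma summable_pow_mul {C : ℝ} {e : ℕ → ℝ} (he : ∀ k, |e k| ≤ C) :
    Summable fun k => M.β ^ k * e k := by
  refine Summable.of_norm_bounded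
    ((summable_geometric_of_lt_one M.β_pos.le M.β_lt_one).mul_right C) fun k => ?_
  rw [norm_mul, norm_pow, Real.norm_of_nonneg M.β_pos.le]
  exact mul_le_mul_of_nonneg_left (he k) (pow_nonneg M.β_pos.le k)

/-- The expected average reward at time `k`. -/
def expReward (π : ℕ → M.DecisionRule N) (x : Fin N → S) (k : ℕ) : ℝ :=
  ∫ ω, M.meanReward ((π k).pair (ω k)) ∂pathLaw (fun n => (π n).kernel) x

variable {M}

lemma abs_expReward_le {C : ℝ} (hC : ∀ x a μ, |M.reward x a μ| ≤ C) (π : ℕ → M.DecisionRule N)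
    (x : Fin N → S) (k : ℕ) : |M.expReward π x k| ≤ C := by
  have := norm_integral_le_of_norm_le_const (μ := pathLaw (fun n => (π n).kernel) x)
    (f := fun ω => M.meanReward ((π k).pair (ω k)))
    (ae_of_all _ fun ω => abs_meanReward_le hC _)
  simpa [expReward] using this

/-- The boundedness of the reward and `β < 1` justify moving the average over individuals inside the
series and the expectation. -/
lemma policyValue_eq (hr : ∀ i : Fin N, Measurable fun p : Fin N → M.D =>
      M.reward (p i).1.1 (p i).1.2 (empirical fun j => (p j).1.1))
    (π : ℕ → M.DecisionRule N) (x : Fin N → S) :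
    M.policyValue π x = ∑' k, M.β ^ k * M.expReward π x k := by
  obtain ⟨C, hC⟩ := M.bounded_reward
  let P := pathLaw (fun n => (π n).kernel) x
  let e : Fin N → ℕ → ℝ := fun i k =>
    ∫ ω, M.reward (ω k i) ((π k).1 (ω k) i) (empirical (ω k)) ∂P
  have he : ∀ i k, |e i k| ≤ C := fun i k => by
    simpa using norm_integral_le_of_norm_le_const (μ := P)
      (f := fun ω => M.reward (ω k i) ((π k).1 (ω k) i) (empirical (ω k)))
      (ae_of_all _ fun ω => hC _ _ _)
  have hint : ∀ i k, Integrable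
      (fun ω : ℕ → Fin N → S => M.reward (ω k i) ((π k).1 (ω k) i) (empirical (ω k))) P :=
    fun i k => Integrable.of_bound
      ((hr i).comp ((π k).measurable_pair.comp (measurable_pi_apply k))).aestronglyMeasurable C
      (ae_of_all _ fun ω => hC _ _ _)
  have hE : ∀ k, M.expReward π x k = (N : ℝ)⁻¹ * ∑ i, e i k := fun k => by
    rw [← integral_finsetSum _ fun i _ => hint i k, ← integral_const_mul]
    rfl
  change (N : ℝ)⁻¹ * ∑ i, ∑' k, M.β ^ k * e i k = _
  rw [← Summable.tsum_finsetSum fun i _ => summable_pow_mul (he i), ← tsum_mul_left]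
  refine tsum_congr fun k => ?_
  rw [hE, ← Finset.mul_sum]
  ring

variable [StandardBorelSpace S] [StandardBorelSpace A]

/-- A policy of the individuals and the policy that it induces in the mean-field MDP have the same
value. -/
lemma policyValueHat_emp_eq (hm : Measurable (M.meanReward (N := N)))
    {π : ℕ → M.DecisionRule N} {ψ : ℕ → M.DecisionRuleHat N} (h : ∀ k, (π k).Induces (ψ k))
    (x : Fin N → S) :
    M.policyValueHat ψ (emp x) = ∑' k, M.β ^ k * M.expReward π x k := by
  refine tsum_congr fun k => congrArg (M.β ^ k * ·) ?_
  let F : EmpiricalMeasures S N → ℝ := fun μ => M.rewardHat μ ((ψ k).1 μ)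
  have hF : F ∘ emp = fun y => M.meanReward ((π k).pair y) := funext fun y => by
    change M.rewardHat (emp y) ((ψ k).1 (emp y)) = _
    rw [← h k y, ← M.rewardHat_emp]
    rfl
  have hFm : Measurable F := by
    refine (measurable_emp.measurable_comp_iff_of_surjective emp_surjective).1 ?_
    rw [hF]
    exact hm.comp (π k).measurable_pair
  have hlaw := pathLaw_map_eval_map (P := fun n => (π n).kernel) (P' := fun n => (ψ n).kernel)
    (x := x) measurable_emp (fun n => (h n).kernel_map) k
  have hk : Measurable fun ω : ℕ → Fin N → S => ω k := measurable_pi_apply k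
  calc ∫ ω, F (ω k) ∂pathLaw (fun n => (ψ n).kernel) (emp x)
      = ∫ μ, F μ ∂(pathLaw (fun n => (ψ n).kernel) (emp x)).map fun ω => ω k :=
        (integral_map (measurable_pi_apply k).aemeasurable hFm.aestronglyMeasurable).symm
    _ = ∫ ω, F (emp (ω k)) ∂pathLaw (fun n => (π n).kernel) x := by
        rw [← hlaw]
        exact integral_map (measurable_emp.comp hk).aemeasurable hFm.aestronglyMeasurable
    _ = M.expReward π x k := integral_congr_ae (ae_of_all _ fun ω => congrFun hF (ω k))

end Values

/-! ### Value iteration -/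

variable {M} in
/-- The nonnegative one-stage reward (shifted by `C`) plus the discounted expectation of `v`. -/
def qValue (C : ℝ) (v : (Fin N → S) → ℝ≥0∞) (p : Fin N → M.D) : ℝ≥0∞ :=
  ENNReal.ofReal (M.meanReward p + C) + ENNReal.ofReal M.β * ∫⁻ y, v y ∂M.sysKernel p

/-- The optimal value over `n` stages of the rewards that are shifted by `C`. -/
def valueIter (C : ℝ) : ℕ → (Fin N → S) → ℝ≥0∞
  | 0 => 0
  | n + 1 => fiberSup Set.univ M.statesOf (M.qValue C (valueIter C n))

variable {M} in
lemma qValue_le_valueIter_succ (C : ℝ) (n : ℕ) (p : Fin N → M.D) :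
    qValue C (M.valueIter C n) p ≤ M.valueIter C (n + 1) (M.statesOf p) :=
  le_iSup₂_of_le (f := fun q (_ : q ∈ Set.univ ∧ M.statesOf q = M.statesOf p) =>
    qValue C (M.valueIter C n) q) p ⟨trivial, rfl⟩ le_rfl

variable {M} in
-- Provides the finite majorant for the reverse Fatou step in `upperSemicontinuous_qValue`; the
-- bound may depend on `n`.
lemma valueIter_le {C : ℝ} (hC : ∀ x a μ, |M.reward x a μ| ≤ C) (n : ℕ) :
    ∃ B ≠ ∞, ∀ x : Fin N → S, M.valueIter C n x ≤ B := by
  induction n with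
  | zero => exact ⟨0, ENNReal.zero_ne_top, fun x => le_rfl⟩
  | succ n ih =>
    obtain ⟨B, hB, hvB⟩ := ih
    refine ⟨ENNReal.ofReal (C + C) + ENNReal.ofReal M.β * B, ENNReal.add_ne_top.2
      ⟨ENNReal.ofReal_ne_top, ENNReal.mul_ne_top ENNReal.ofReal_ne_top hB⟩,
      fun x => iSup₂_le fun p _ => add_le_add (ENNReal.ofReal_le_ofReal ?_) ?_⟩
    · linarith [(abs_le.1 (abs_meanReward_le hC p)).2]
    · gcongr
      calc ∫⁻ y, M.valueIter C n y ∂M.sysKernel p ≤ ∫⁻ _, B ∂M.sysKernel p := lintegral_mono hvB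
        _ = B := by simp

/-- Links the extended nonnegative integrals of the backward induction to real expectations; the
shift by `C` ensures that `ENNReal.ofReal` truncates nothing. -/
lemma sum_expReward_eq {C : ℝ} (hC : ∀ x a μ, |M.reward x a μ| ≤ C)
    (hm : Measurable (M.meanReward (N := N)))
    (π : ℕ → M.DecisionRule N) (x : Fin N → S) (n : ℕ) :
    ∑ k ∈ Finset.range n, ENNReal.ofReal M.β ^ k *
        ∫⁻ ω, ENNReal.ofReal (M.meanReward ((π k).pair (ω k)) + C)
          ∂pathLaw (fun n => (π n).kernel) x =
      ENNReal.ofReal (∑ k ∈ Finset.range n, M.β ^ k * (M.expReward π x k + C)) := by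
  have hpos : ∀ p : Fin N → M.D, 0 ≤ M.meanReward p + C := fun p => by
    linarith [(abs_le.1 (abs_meanReward_le hC p)).1]
  have hpos' : ∀ k, 0 ≤ M.expReward π x k + C := fun k => by
    linarith [(abs_le.1 (abs_expReward_le hC π x k)).1]
  rw [ENNReal.ofReal_sum_of_nonneg fun k _ => mul_nonneg (pow_nonneg M.β_pos.le k) (hpos' k)]
  refine Finset.sum_congr rfl fun k _ => ?_
  have hint : Integrable (fun ω : ℕ → Fin N → S => M.meanReward ((π k).pair (ω k)))
      (pathLaw (fun n => (π n).kernel) x) := Integrable.of_bound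
    (hm.comp ((π k).measurable_pair.comp (measurable_pi_apply k))).aestronglyMeasurable C
    (ae_of_all _ fun ω => abs_meanReward_le hC _)
  rw [ENNReal.ofReal_mul (pow_nonneg M.β_pos.le k), ENNReal.ofReal_pow M.β_pos.le]
  refine congrArg _ ((ofReal_integral_eq_lintegral_ofReal (hint.add (integrable_const C))
    (ae_of_all _ fun ω => hpos _)).symm.trans (congrArg _ ?_))
  refine (integral_add hint (integrable_const C)).trans ?_
  simp [expReward]

/-! ### Permutation invariance of the value iteration -/

section Symmetry

variable [StandardBorelSpace S] [StandardBorelSpace A]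

variable {M} in
-- A symmetric `v` factors measurably through `emp`, so its expectation depends only on the law of
-- the next empirical measure, which `emp p` determines.
lemma qValue_congr_emp {C : ℝ} {v : (Fin N → S) → ℝ≥0∞} (hv : Measurable v)
    (hsymm : ∀ y (σ : Equiv.Perm (Fin N)), v (y ∘ σ) = v y) {p q : Fin N → M.D}
    (h : emp p = emp q) : qValue C v p = qValue C v q := by
  obtain ⟨s, hs, hse⟩ := exists_measurable_rightInverse_emp (E := S) (N := N)
  have hvs : ∀ y, v y = v (s (emp y)) := fun y => by
    obtain ⟨σ, hσ⟩ := exists_perm_of_emp_eq (hse (emp y)).symm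
    rw [hσ, hsymm]
  have hint : ∀ p : Fin N → M.D, ∫⁻ y, v y ∂M.sysKernel p =
      ∫⁻ μ, v (s μ) ∂(M.sysKernel p).map emp := fun p => by
    refine (lintegral_congr hvs).trans ?_
    exact (lintegral_map (f := fun μ => v (s μ)) (hv.comp hs) measurable_emp).symm
  obtain ⟨σ, hσ⟩ := exists_perm_of_emp_eq h
  rw [qValue, qValue, hint, hint, M.sysKernel_map_emp_eq h, hσ, meanReward_comp_perm]

/-- Composition with `σ` maps the fiber over `x` onto the fiber over `x ∘ σ` and preserves `qValue`.
-/
lemma fiberSup_qValue_comp_perm {C : ℝ} {v : (Fin N → S) → ℝ≥0∞} (hv : Measurable v)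
    (hsymm : ∀ y (σ : Equiv.Perm (Fin N)), v (y ∘ σ) = v y) (x : Fin N → S)
    (σ : Equiv.Perm (Fin N)) :
    fiberSup Set.univ M.statesOf (M.qValue C v) (x ∘ σ) =
      fiberSup Set.univ M.statesOf (M.qValue C v) x := by
  have key : ∀ (x : Fin N → S) (σ : Equiv.Perm (Fin N)),
      fiberSup Set.univ M.statesOf (M.qValue C v) x ≤
        fiberSup Set.univ M.statesOf (M.qValue C v) (x ∘ σ) := fun x σ => by
    refine iSup₂_le fun p hp => ?_
    rw [← qValue_congr_emp hv hsymm (emp_comp_perm p σ)]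
    refine le_iSup₂_of_le (f := fun q (_ : q ∈ Set.univ ∧ M.statesOf q = x ∘ σ) =>
      M.qValue C v q) (p ∘ σ) ⟨trivial, ?_⟩ le_rfl
    rw [← hp.2]
    rfl
  refine le_antisymm ?_ (key x σ)
  have := key (x ∘ σ) σ⁻¹
  rwa [Function.comp_assoc, ← Equiv.Perm.coe_mul, mul_inv_cancel, Equiv.Perm.coe_one,
    Function.comp_id] at this

end Symmetry

/-! ### Optimal decision rules -/

section Topological

variable {M}

/-! ### Semicontinuity of the one-step data -/

section Continuity

variable [TopologicalSpace S] [OpensMeasurableSpace S] [TopologicalSpace A]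

lemma continuous_individual (i : Fin N) : Continuous fun p : Fin N → M.D =>
    (((p i).1.1, (p i).1.2, empirical fun j => (p j).1.1) : S × A × ProbabilityMeasure S) := by
  have h : Continuous fun p : Fin N → M.D => (p i).1 :=
    continuous_subtype_val.comp (continuous_apply i)
  exact (continuous_fst.comp h).prodMk
    ((continuous_snd.comp h).prodMk (continuous_empirical.comp continuous_statesOf))

lemma A2.upperSemicontinuous_reward (hA2 : M.A2) (i : Fin N) :
    UpperSemicontinuous fun p : Fin N → M.D =>
      M.reward (p i).1.1 (p i).1.2 (empirical fun j => (p j).1.1) :=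
  UpperSemicontinuous.comp hA2 (continuous_individual i)

lemma A2.upperSemicontinuous_meanReward (hA2 : M.A2) :
    UpperSemicontinuous (M.meanReward (N := N)) :=
  (continuous_const_mul (N : ℝ)⁻¹).comp_upperSemicontinuous
    (upperSemicontinuous_sum fun i _ => hA2.upperSemicontinuous_reward i)
    fun _ _ h => mul_le_mul_of_nonneg_left h (by positivity)

lemma A3.continuous_sysTrans (hA3 : M.A3) (z : (Fin N → Z) × Z) :
    Continuous fun p : Fin N → M.D => M.sysTrans p z :=
  continuous_pi fun i => (hA3 (z.1 i) z.2).comp (continuous_individual i)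

end Continuity

variable [TopologicalSpace S] [PolishSpace S] [BorelSpace S]
  [TopologicalSpace A] [TopologicalSpace.MetrizableSpace A] [SecondCountableTopology A]
  [BorelSpace A]

/-- Written as an integral over the noise, whose law does not depend on `p`, the expectation has
integrand `v (M.sysTrans p z)`, which is upper semicontinuous in `p` for each fixed `z`. -/
lemma upperSemicontinuous_qValue (hA2 : M.A2) (hA3 : M.A3) (C : ℝ) {v : (Fin N → S) → ℝ≥0∞}
    (hv : UpperSemicontinuous v) {B : ℝ≥0∞} (hB : B ≠ ∞) (hvB : ∀ x, v x ≤ B) :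
    UpperSemicontinuous (M.qValue C v) := by
  have h1 : UpperSemicontinuous fun p : Fin N → M.D => ENNReal.ofReal (M.meanReward p + C) :=
    (ENNReal.continuous_ofReal.comp (continuous_add_const C)).comp_upperSemicontinuous
      hA2.upperSemicontinuous_meanReward
      fun a b h => ENNReal.ofReal_le_ofReal (add_le_add_left h C)
  have hm : ∀ p : Fin N → M.D, Measurable (M.sysTrans p) := fun p =>
    M.measurable_sysTrans.comp measurable_prodMk_left
  have h2 : UpperSemicontinuous fun p : Fin N → M.D => ∫⁻ y, v y ∂M.sysKernel p := by
    have h : ∀ p : Fin N → M.D, ∫⁻ y, v y ∂M.sysKernel p =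
        ∫⁻ z, v (M.sysTrans p z) ∂M.noise N := fun p => lintegral_map hv.measurable (hm p)
    simp only [h]
    exact upperSemicontinuous_lintegral (fun z => hv.comp (hA3.continuous_sysTrans z))
      (fun p => hv.measurable.comp (hm p)) hB fun p z => hvB _
  exact h1.add ((ENNReal.continuous_const_mul ENNReal.ofReal_ne_top).comp_upperSemicontinuous h2
    fun _ _ h => mul_le_mul_right h _)

variable (hA0 : M.A0) (hA2 : M.A2) (hA3 : M.A3) {C : ℝ}
  (hC : ∀ x a μ, |M.reward x a μ| ≤ C)

include hA0 hA2 hA3 hC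

lemma upperSemicontinuous_valueIter (n : ℕ) :
    UpperSemicontinuous (M.valueIter (N := N) C n) := by
  have : CompactSpace M.D := isCompact_iff_compactSpace.1 hA0
  induction n with
  | zero => exact upperSemicontinuous_const
  | succ n ih =>
    obtain ⟨B, hB, hvB⟩ := valueIter_le (N := N) hC n
    exact upperSemicontinuous_fiberSup isClosed_univ continuous_statesOf
      (upperSemicontinuous_qValue hA2 hA3 C ih hB hvB)

variable [StandardBorelSpace A]

lemma valueIter_comp_perm (n : ℕ) (x : Fin N → S) (σ : Equiv.Perm (Fin N)) :
    M.valueIter C n (x ∘ σ) = M.valueIter C n x := by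
  induction n generalizing x σ with
  | zero => rfl
  | succ n ih =>
    exact M.fiberSup_qValue_comp_perm
      (upperSemicontinuous_valueIter hA0 hA2 hA3 hC n).measurable ih x σ

/-- There is an optimal decision rule for the first of `n + 1` stages that is induced by a decision
rule of the mean-field. -/
lemma exists_optimal_rule (n : ℕ) : ∃ (f : M.DecisionRule N) (φ : M.DecisionRuleHat N),
    f.Induces φ ∧ ∀ x, qValue C (M.valueIter C n) (f.pair x) = M.valueIter C (n + 1) x := by
  have : CompactSpace M.D := isCompact_iff_compactSpace.1 hA0
  have husc := upperSemicontinuous_valueIter (N := N) hA0 hA2 hA3 hC n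
  have hsymm := valueIter_comp_perm (N := N) hA0 hA2 hA3 hC
  rcases isEmpty_or_nonempty (Fin N → M.D) with hemp | hne
  · have hS : IsEmpty (Fin N → S) :=
      ⟨fun x => hemp.elim (M.statesOf_surjective x).choose⟩
    exact ⟨Classical.arbitrary _, Classical.arbitrary _, isEmptyElim, isEmptyElim⟩
  obtain ⟨B, hB, hvB⟩ := valueIter_le (N := N) hC n
  obtain ⟨p, hp, hpx⟩ := exists_measurable_argmax continuous_statesOf
    (M.statesOf_surjective (N := N)) (upperSemicontinuous_qValue hA2 hA3 C husc hB hvB)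
  have hadm : ∀ x i, (p x i).1.2 ∈ M.adm (x i) := fun x i => by
    have h := (p x i).2
    have hx : (p x i).1.1 = x i := congrFun (hpx x).1 i
    rw [← hx]
    exact h
  let g : M.DecisionRule N := ⟨fun x i => (p x i).1.2, measurable_pi_lambda _ fun i =>
    measurable_snd.comp (measurable_subtype_coe.comp ((measurable_pi_apply i).comp hp)), hadm⟩
  have hg : ∀ x, g.pair x = p x := fun x => funext fun i =>
    Subtype.ext (Prod.ext (congrFun (hpx x).1 i).symm rfl)
  -- The maximizer `g` need not be symmetric. Passing to `φ` and back to `f` gives pairs with the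
  -- empirical measure of `g.pair (x ∘ σ)`; these are still optimal at `x`, because both `qValue`
  -- and the optimal value ignore permutations.
  obtain ⟨φ, hφ⟩ := M.exists_decisionRuleHat g
  obtain ⟨f, hf⟩ := M.exists_induces φ
  refine ⟨f, φ, hf, fun x => ?_⟩
  obtain ⟨σ, hσ⟩ := hφ x
  rw [qValue_congr_emp husc.measurable (hsymm n) ((hf x).trans hσ), hg, (hpx (x ∘ σ)).2]
  exact hsymm (n + 1) x σ

/-- Up to any finite horizon, policies that are induced by policies of the mean-field MDP perform
at least as well as any other policy. -/
lemma exists_induces_sum_le (π : ℕ → M.DecisionRule N) (x : Fin N → S) (n : ℕ) :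
    ∃ (π' : ℕ → M.DecisionRule N) (ψ : ℕ → M.DecisionRuleHat N), (∀ k, (π' k).Induces (ψ k)) ∧
      ∑ k ∈ Finset.range n, M.β ^ k * (M.expReward π x k + C) ≤
        ∑ k ∈ Finset.range n, M.β ^ k * (M.expReward π' x k + C) := by
  choose f φ hfφ hopt using exists_optimal_rule (N := N) hA0 hA2 hA3 hC
  -- At time `k < n`, `n - (k + 1)` further stages follow the current one. From time `n` on the
  -- subtraction truncates to `0`, a choice without effect on the sums.
  let π' : ℕ → M.DecisionRule N := fun k => f (n - (k + 1))
  refine ⟨π', fun k => φ (n - (k + 1)), fun k => hfφ _, ?_⟩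
  have hm : Measurable (M.meanReward (N := N)) := hA2.upperSemicontinuous_meanReward.measurable
  have hρ : ∀ (π : ℕ → M.DecisionRule N) k, Measurable fun y =>
      ENNReal.ofReal (M.meanReward ((π k).pair y) + C) := fun π k =>
    ENNReal.measurable_ofReal.comp ((hm.comp (π k).measurable_pair).add_const C)
  let w : ℕ → (Fin N → S) → ℝ≥0∞ := fun k => M.valueIter C (n - k)
  have hw : ∀ k, Measurable (w k) := fun k =>
    (upperSemicontinuous_valueIter hA0 hA2 hA3 hC _).measurable
  have hwn : w n = 0 := by simp only [w, Nat.sub_self]; rfl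
  have hk : ∀ k < n, n - k = n - (k + 1) + 1 := fun k hk => by omega
  -- The value `w k` of the remaining stages satisfies the one-step inequality for every rule and
  -- equality for the optimal rules, so `w 0 x` separates the two sums.
  have hle := sum_lintegral_pathLaw_le (P := fun k => (π k).kernel) (x := x) (n := n)
    (b := ENNReal.ofReal M.β) (hρ π) hw fun k hkn y => by
      simp only [w]
      rw [hk k hkn]
      exact qValue_le_valueIter_succ C _ ((π k).pair y)
  have hge := le_sum_lintegral_pathLaw (P := fun k => (π' k).kernel) (x := x) (n := n)
    (b := ENNReal.ofReal M.β) (hρ π') hw fun k hkn y => by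
      simp only [w]
      rw [hk k hkn]
      exact (hopt _ y).ge
  have h := hle.trans hge
  simp only [hwn, Pi.zero_apply, lintegral_zero, mul_zero, add_zero] at h
  rw [M.sum_expReward_eq hC hm, M.sum_expReward_eq hC hm] at h
  refine (ENNReal.ofReal_le_ofReal_iff (Finset.sum_nonneg fun k _ =>
    mul_nonneg (pow_nonneg M.β_pos.le k) ?_)).1 h
  linarith [(abs_le.1 (abs_expReward_le hC π' x k)).1]

end Topological

end Model

end MeanFieldMDP

end

/-! ### Equality of the value functions -/

theorem theorem3p2 {S A Z : Type*}
    [TopologicalSpace S] [PolishSpace S] [CompactSpace S] [MeasurableSpace S] [BorelSpace S]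
    [TopologicalSpace A] [TopologicalSpace.MetrizableSpace A] [SecondCountableTopology A]
    [MeasurableSpace A] [BorelSpace A] [StandardBorelSpace A]
    [MeasurableSpace Z] [StandardBorelSpace Z]
    (M : MeanFieldMDP.Model S A Z) (hA0 : M.A0) (hA1 : M.A1) (hA2 : M.A2) (hA3 : M.A3)
    (N : ℕ) [NeZero N] (x : Fin N → S) :
    M.value x = M.valueHat (MeanFieldMDP.emp x) := by
  open MeanFieldMDP MeanFieldMDP.Model in
  obtain ⟨C, hC⟩ := M.bounded_reward
  have hm : Measurable (M.meanReward (N := N)) := hA2.upperSemicontinuous_meanReward.measurable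
  have hV : ∀ π : ℕ → M.DecisionRule N,
      M.policyValue π x = ∑' k, M.β ^ k * M.expReward π x k := fun π =>
    policyValue_eq (fun i => (hA2.upperSemicontinuous_reward i).measurable) π x
  have hsum : ∀ π : ℕ → M.DecisionRule N, Summable fun k => M.β ^ k * M.expReward π x k :=
    fun π => summable_pow_mul (abs_expReward_le hC π x)
  have hgeom : Summable fun k => M.β ^ k * C :=
    (summable_geometric_of_lt_one M.β_pos.le M.β_lt_one).mul_right C
  -- `K` is the total discounted effect of adding `C` to every reward, the same for all policies.
  let K : ℝ := ∑' k, M.β ^ k * C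
  have hshift : ∀ π : ℕ → M.DecisionRule N,
      HasSum (fun k => M.β ^ k * (M.expReward π x k + C)) (M.policyValue π x + K) := fun π => by
    simp only [mul_add, hV]
    exact (hsum π).hasSum.add hgeom.hasSum
  have hbdd : BddAbove (Set.range fun π : ℕ → M.DecisionRule N => M.policyValue π x) := by
    refine ⟨K, ?_⟩
    rintro _ ⟨π, rfl⟩
    change M.policyValue π x ≤ K
    rw [hV]
    exact (hsum π).tsum_le_tsum (fun k => mul_le_mul_of_nonneg_left
      (abs_le.1 (abs_expReward_le hC π x k)).2 (pow_nonneg M.β_pos.le k)) hgeom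
  have hHat : ∀ (π : ℕ → M.DecisionRule N) (ψ : ℕ → M.DecisionRuleHat N),
      (∀ k, (π k).Induces (ψ k)) → M.policyValueHat ψ (emp x) = M.policyValue π x :=
    fun π ψ h => (policyValueHat_emp_eq hm h x).trans (hV π).symm
  have hle : ∀ ψ : ℕ → M.DecisionRuleHat N, M.policyValueHat ψ (emp x) ≤ M.value x := fun ψ => by
    choose f hf using fun k => M.exists_induces (ψ k)
    rw [hHat f ψ hf]
    exact le_ciSup hbdd f
  refine le_antisymm (ciSup_le fun π => ?_) (ciSup_le hle)
  suffices M.policyValue π x + K ≤ M.valueHat (emp x) + K by linarith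
  -- The comparison policy depends on the horizon `n`, so each partial sum is bounded by the
  -- `n`-independent right-hand side before the limit is taken.
  refine le_of_tendsto' (hshift π).tendsto_sum_nat fun n => ?_
  obtain ⟨π', ψ, hψ, hn⟩ := exists_induces_sum_le hA0 hA2 hA3 hC π x n
  calc _ ≤ _ := hn
    _ ≤ M.policyValue π' x + K := sum_le_hasSum _ (fun k _ => mul_nonneg
        (pow_nonneg M.β_pos.le k)
        (by linarith [(abs_le.1 (abs_expReward_le hC π' x k)).1])) (hshift π')
    _ ≤ M.valueHat (emp x) + K := by
        rw [← hHat π' ψ hψ]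
        gcongr
        exact le_ciSup (f := fun ψ => M.policyValueHat ψ (emp x))
          ⟨M.value x, by rintro _ ⟨ψ, rfl⟩; exact hle ψ⟩ ψ
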